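/- Let $(R,\mathfrak m)$ be a one-dimensional Cohen–Macaulay Noetherian local ring. For an $\mathfrak m$-primary ideal $I$ let $\mu(I)$ be the minimal number of generators of $I$, let $\ell\ell(I)$ be the smallest integer $n$ with $\mathfrak m^n\subseteq I$ (the Loewy length of $R/I$), and let $\operatorname{e}(I)=\lim_{n\to\infty}\ell(R/I^n)/n$ be the Hilbert–Samuel multiplicity of $I$ (this limit exists); put $\operatorname{e}(R)=\operatorname{e}(\mathfrak m)$. Then the inequality \[ \mu(I)\,\ell\ell(I)\ \ge\ \operatorname{e}(I) \] holds for every integrally closed $\mathfrak m$-primary ideal $I$ of $R$ if and only if $R$ has minimal multiplicity, i.e. $\operatorname{e}(R)=\mu(\mathfrak m)$. -/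

import Mathlib

open Filter Topology
open scoped Nat

/-- A (Noetherian) local ring is Cohen–Macaulay if its maximal ideal contains an `R`-regular
sequence whose length is the Krull dimension of `R`; as the length of a regular sequence never
exceeds the dimension, this says that depth and dimension agree. -/
def IsCohenMacaulayLocal (R : Type*) [CommRing R] [IsLocalRing R] : Prop :=
  ∃ rs : List R, (∀ r ∈ rs, r ∈ IsLocalRing.maximalIdeal R) ∧
    RingTheory.Sequence.IsRegular R rs ∧ ringKrullDim R = rs.length

/-- `x` is integral over the ideal `I`: there are `n ≥ 1` and `aᵢ ∈ I ^ i` for `1 ≤ i ≤ n` with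
`x ^ n + a₁ x ^ (n - 1) + ⋯ + aₙ = 0`. -/
def Ideal.IsIntegralElement {R : Type*} [CommRing R] (I : Ideal R) (x : R) : Prop :=
  ∃ n : ℕ, 1 ≤ n ∧ ∃ a : ℕ → R, (∀ i ∈ Finset.Icc 1 n, a i ∈ I ^ i) ∧
    x ^ n + ∑ i ∈ Finset.Icc 1 n, a i * x ^ (n - i) = 0

/-- An ideal is integrally closed if it contains every element that is integral over it. -/
def Ideal.IsIntegrallyClosedIdeal {R : Type*} [CommRing R] (I : Ideal R) : Prop :=
  ∀ x : R, I.IsIntegralElement x → x ∈ I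

/-- `I` is `𝔪`-primary for the maximal ideal `𝔪` of the local ring `R`. -/
def Ideal.IsMaximalPrimary {R : Type*} [CommRing R] [IsLocalRing R] (I : Ideal R) : Prop :=
  I.IsPrimary ∧ I.radical = IsLocalRing.maximalIdeal R

/-- The Loewy length `ℓℓ(I)` of `R / I`: the smallest `n` with `𝔪 ^ n ⊆ I`. -/
noncomputable def Ideal.loewyLength {R : Type*} [CommRing R] [IsLocalRing R]
    (I : Ideal R) : ℕ :=
  sInf {n : ℕ | IsLocalRing.maximalIdeal R ^ n ≤ I}

/-- The sequence `d! ℓ(R / I ^ n) / n ^ d`, where `d` is the Krull dimension of `R` and `ℓ` is the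
length of an `R`-module. -/
noncomputable def Ideal.normalizedHilbertSamuel {R : Type*} [CommRing R]
    (I : Ideal R) (n : ℕ) : ℝ :=
  let d : ℕ := ((ringKrullDim R).unbotD 0).toNat
  (d ! : ℝ) * ((Module.length R (R ⧸ I ^ n)).toNat : ℝ) / (n : ℝ) ^ d

/-- The Hilbert–Samuel multiplicity `e(I) = lim d! ℓ(R / I ^ n) / n ^ d`. -/
noncomputable def Ideal.hilbertSamuelMultiplicity {R : Type*} [CommRing R]
    (I : Ideal R) : ℝ :=
  limUnder atTop I.normalizedHilbertSamuel

/-! Write S = R(X), 𝔪 for the maximal ideal, μ for the number of generators and ℓ for length. Two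
inequalities always hold: e(I) ≤ ℓℓ(I) e(R), because 𝔪^(ln) ⊆ I^n for l = ℓℓ(I), and μ(𝔪) ≤ e(R).
Taking I = 𝔪, where ℓℓ(𝔪) ≤ 1, the asserted bound forces e(R) = μ(𝔪). Conversely, if e(R) = μ(𝔪),
then e(I) ≤ ℓℓ(I) μ(𝔪), and it remains to see that μ(𝔪) ≤ μ(I) for integrally closed I.

The tool is a principal reduction y of IS, so that I^(k+1)S = y I^k S. The extension S is flat with
𝔪S maximal, so it preserves colengths, and its residue field is infinite. Since μ(I^n) ≤ ℓ(R/t) for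
every n and a fixed regular t ∈ 𝔪, an Eakin–Sathaye argument produces y. Then ℓ(R/I^n) is eventually
linear with slope ℓ(S/y), so the limit exists and e(I) = ℓ(S/y).

For y reducing 𝔪S and I integrally closed, the determinantal trick gives (𝔪IS : y) = IS, so μ(I) =
ℓ(S/(𝔪I, y)) ≥ ℓ(S/(𝔪², y)) ≥ μ(𝔪). -/

/-- The length of `R / I` as an `R`-module. -/
noncomputable def Ideal.colength {R : Type*} [CommRing R] (I : Ideal R) : ℕ∞ :=
  Module.length R (R ⧸ I)

/-! ### Colength: exact sequences, generators and base change -/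

namespace Ideal

variable {R : Type*} [CommRing R]

theorem colength_anti {I J : Ideal R} (h : I ≤ J) : J.colength ≤ I.colength :=
  Module.length_le_of_surjective (Submodule.factor h) (Submodule.factor_surjective h)

/-- Additivity of length on 0 → R/(K : y) → R/K → R/(K + (y)) → 0, whose first map is multiplication
by y. -/
theorem colength_eq_colength_colon_add {K K' : Ideal R} {y : R}
    (h : ∀ v, v ∈ K' ↔ y * v ∈ K) :
    K.colength = K'.colength + (K ⊔ span {y}).colength := by
  have hle : K' ≤ Submodule.comap (LinearMap.mulLeft R y) K := fun v hv => (h v).1 hv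
  refine Module.length_eq_add_of_exact
    (Submodule.mapQ K' K (LinearMap.mulLeft R y) hle)
    (Submodule.factor (le_sup_left : K ≤ K ⊔ span {y})) ?_ (Submodule.factor_surjective _) ?_
  · rw [← LinearMap.ker_eq_bot, LinearMap.ker_eq_bot']
    intro m hm
    obtain ⟨v, rfl⟩ := Submodule.Quotient.mk_surjective _ m
    rw [Submodule.mapQ_apply, Submodule.Quotient.mk_eq_zero] at hm
    rw [Submodule.Quotient.mk_eq_zero]
    exact (h v).2 hm
  · intro m
    obtain ⟨v, rfl⟩ := Submodule.Quotient.mk_surjective _ m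
    constructor
    · intro hv
      have hv' : v ∈ K ⊔ span {y} := by
        rwa [← Submodule.Quotient.mk_eq_zero]
      obtain ⟨a, ha, b, hb, rfl⟩ := Submodule.mem_sup.1 hv'
      obtain ⟨c, rfl⟩ := mem_span_singleton'.1 hb
      refine ⟨Submodule.Quotient.mk c, ?_⟩
      rw [Submodule.mapQ_apply, Submodule.Quotient.eq]
      have : y * c - (a + c * y) = -a := by ring
      simpa [this] using ha
    · rintro ⟨w, hw⟩
      obtain ⟨c, rfl⟩ := Submodule.Quotient.mk_surjective _ w
      rw [← hw, Submodule.mapQ_apply]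
      refine (Submodule.Quotient.mk_eq_zero _).2 ?_
      exact mem_sup_right (mul_mem_right _ _ (mem_span_singleton_self y))

theorem colength_span_singleton_mul {y : R} (hy : y ∈ nonZeroDivisors R) (J : Ideal R) :
    (span {y} * J).colength = J.colength + (span {y}).colength := by
  have h := colength_eq_colength_colon_add (K := span {y} * J) (K' := J) (y := y) (fun v => by
    constructor
    · exact fun hv => mul_mem_mul (mem_span_singleton_self y) hv
    · intro hv
      obtain ⟨z, hz, hzy⟩ := mem_span_singleton_mul.1 hv
      rwa [← mul_cancel_left_mem_nonZeroDivisors hy |>.1 hzy])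
  rwa [sup_eq_right.2 mul_le_left] at h

theorem colength_span_singleton_pow_mul {y : R} (hy : y ∈ nonZeroDivisors R) (J : Ideal R) (n : ℕ) :
    (span {y} ^ n * J).colength = J.colength + n * (span {y}).colength := by
  induction n with
  | zero => simp
  | succ n ih =>
    rw [pow_succ', mul_assoc, colength_span_singleton_mul hy, ih]
    push_cast
    ring

/-- By Nakayama, μ(I) is the dimension of I/𝔪I over the residue field. This turns every generator
count below into a difference of colengths. -/
theorem colength_maximalIdeal_mul [IsLocalRing R] [IsNoetherianRing R] (I : Ideal R) :
    (IsLocalRing.maximalIdeal R * I).colength = I.colength + I.spanFinrank := by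
  set m := IsLocalRing.maximalIdeal R
  have hker : (m • ⊤ : Submodule R I) ≤ Submodule.comap I.subtype (m * I) := by
    rw [← Submodule.map_le_iff_le_comap, Submodule.map_smul'', Submodule.map_top,
      Submodule.range_subtype, smul_eq_mul]
  have hexact := Module.length_eq_add_of_exact
    (Submodule.mapQ (m • ⊤ : Submodule R I) (m * I) I.subtype hker)
    (Submodule.factor (mul_le_right : m * I ≤ I)) ?_ (Submodule.factor_surjective _) ?_
  · rw [IsLocalRing.spanFinrank_eq_finrank_quotient I (IsNoetherian.noetherian I), colength, hexact,
      add_comm, colength]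
    congr 1
    let : Field (R ⧸ m) := Ideal.Quotient.field m
    rw [Module.length_eq_of_surjective (S := R) (R := R ⧸ m) Ideal.Quotient.mk_surjective]
    exact Module.length_eq_finrank _ _
  · rw [← LinearMap.ker_eq_bot, LinearMap.ker_eq_bot']
    intro x hx
    obtain ⟨v, rfl⟩ := Submodule.Quotient.mk_surjective _ x
    rw [Submodule.mapQ_apply, Submodule.Quotient.mk_eq_zero] at hx
    rw [Submodule.Quotient.mk_eq_zero]
    have hmap : (m • ⊤ : Submodule R I).map I.subtype = m * I := by
      rw [Submodule.map_smul'', Submodule.map_top, Submodule.range_subtype, smul_eq_mul]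
    rw [← hmap] at hx
    obtain ⟨w, hw, hwv⟩ := hx
    rwa [← I.injective_subtype hwv]
  · intro x
    obtain ⟨v, rfl⟩ := Submodule.Quotient.mk_surjective _ x
    constructor
    · intro hv
      have hv' : v ∈ I := by rwa [← Submodule.Quotient.mk_eq_zero]
      exact ⟨Submodule.Quotient.mk ⟨v, hv'⟩, rfl⟩
    · rintro ⟨w, hw⟩
      obtain ⟨c, rfl⟩ := Submodule.Quotient.mk_surjective _ w
      rw [← hw, Submodule.mapQ_apply]
      exact (Submodule.Quotient.mk_eq_zero _).2 c.2

/-- Flat base change multiplies length by that of the closed fibre S/𝔪S, which is 1 here. -/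
theorem colength_map {S : Type*} [CommRing S] [Algebra R S] [IsLocalRing R] [IsLocalRing S]
    [IsLocalHom (algebraMap R S)] [Module.Flat R S]
    (hm : (IsLocalRing.maximalIdeal R).map (algebraMap R S) = IsLocalRing.maximalIdeal S)
    (I : Ideal R) : (I.map (algebraMap R S)).colength = I.colength := by
  have h := IsLocalRing.length_baseChange R S (R ⧸ I)
  have h1 : Module.length S (S ⧸ IsLocalRing.maximalIdeal S) = 1 := by
    rw [Module.length_eq_one_iff, isSimpleModule_iff_isCoatom]
    exact Ideal.isMaximal_def.1 inferInstance
  rw [hm, h1, mul_one] at h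
  rw [colength, colength, ← h]
  exact (Algebra.TensorProduct.quotIdealMapEquivTensorQuot S I).toLinearEquiv.length_eq

/-- Compare tI ⊆ 𝔪I. The bound does not depend on I, so it applies to all powers of an ideal at
once. -/
theorem spanFinrank_le_colength [IsLocalRing R] [IsNoetherianRing R] {t : R}
    (ht : t ∈ nonZeroDivisors R) (htm : t ∈ IsLocalRing.maximalIdeal R) {I : Ideal R}
    (hI : I.colength ≠ ⊤) : (I.spanFinrank : ℕ∞) ≤ (span {t}).colength := by
  have h1 := colength_anti (mul_mono_left (K := I)
    ((span_singleton_le_iff_mem (IsLocalRing.maximalIdeal R)).2 htm))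
  rw [colength_maximalIdeal_mul, colength_span_singleton_mul ht] at h1
  exact (ENat.add_le_add_iff_left hI).1 h1

end Ideal

/-! ### Principal reductions over an infinite residue field -/

namespace IsLocalRing

variable {S : Type*} [CommRing S] [IsLocalRing S]

/-- A linear dependence modulo the maximal ideal among more elements than there are generators. -/
theorem exists_sum_mul_mem_maximalIdeal_mul {J : Ideal S} (hJ : J.FG) {n : ℕ}
    (hn : J.spanFinrank ≤ n) (z : Fin (n + 1) → S) (hz : ∀ i, z i ∈ J) :
    ∃ c : Fin (n + 1) → S, (∃ i, c i ∉ maximalIdeal S) ∧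
      ∑ i, c i * z i ∈ maximalIdeal S * J := by
  obtain ⟨s, hs, hsJ⟩ := Submodule.FG.exists_span_finset_card_eq_spanFinrank hJ
  have hM : ∀ i, ∃ M : s → S, ∑ j, M j * (j : S) = z i := by
    intro i
    have h := hz i
    rw [← hsJ, Submodule.mem_span_finset'] at h
    exact h
  choose M hM using hM
  let f : (Fin (n + 1) → ResidueField S) →ₗ[ResidueField S] (s → ResidueField S) :=
    Matrix.vecMulLinear (Matrix.of fun i j => residue S (M i j))
  have hker : LinearMap.ker f ≠ ⊥ := by
    apply LinearMap.ker_ne_bot_of_finrank_lt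
    simp only [Module.finrank_fintype_fun_eq_card, Fintype.card_coe, Fintype.card_fin]
    omega
  obtain ⟨c', hc', hc0⟩ := (Submodule.ne_bot_iff _).1 hker
  choose c hc using fun i => residue_surjective (R := S) (c' i)
  refine ⟨c, ?_, ?_⟩
  · obtain ⟨i, hi⟩ := Function.ne_iff.1 hc0
    refine ⟨i, fun h => hi ?_⟩
    rw [← hc, (residue_eq_zero_iff _).2 h]
    rfl
  · have : ∑ i, c i * z i = ∑ j : s, (∑ i, c i * M i j) * (j : S) := by
      simp_rw [← hM, Finset.mul_sum, Finset.sum_mul]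
      rw [Finset.sum_comm]
      simp_rw [mul_assoc]
    rw [this]
    refine Ideal.sum_mem _ fun j _ => Ideal.mul_mem_mul ?_ ?_
    · rw [← residue_eq_zero_iff, map_sum]
      have := congrFun (LinearMap.mem_ker.1 hc') j
      simpa [f, Matrix.vecMul, dotProduct, hc] using this
    · rw [← hsJ]
      exact Ideal.subset_span j.2

/-- Among the elements `a - λ b` there is one on which `b` depends integrally
modulo `𝔫 I ^ n`, provided that `I ^ n` has at most `n` generators. -/
theorem exists_pow_mem_of_spanFinrank_pow_le [Infinite (ResidueField S)] {I : Ideal S} {n : ℕ}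
    (hfg : (I ^ n).FG) (hn : (I ^ n).spanFinrank ≤ n) {a b : S} (ha : a ∈ I) (hb : b ∈ I) :
    ∃ l : S, b ^ n ∈ Ideal.span {a - l * b} * I ^ (n - 1) ⊔ maximalIdeal S * I ^ n := by
  -- There are n + 1 monomials of degree n in a, b, one more than the generators of I^n, so they are
  -- dependent modulo 𝔫I^n.
  obtain ⟨c, ⟨i₀, hi₀⟩, hc⟩ := exists_sum_mul_mem_maximalIdeal_mul hfg hn
    (fun i => a ^ (i : ℕ) * b ^ (n - i)) (fun i => by
      have : I ^ n = I ^ (i : ℕ) * I ^ (n - i) := by rw [← pow_add]; congr 1; omega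
      rw [this]
      exact Ideal.mul_mem_mul (Ideal.pow_mem_pow ha _) (Ideal.pow_mem_pow hb _))
  let P : Polynomial (ResidueField S) :=
    ∑ i : Fin (n + 1), Polynomial.monomial (i : ℕ) (residue S (c i))
  have hP : P ≠ 0 := by
    intro h
    apply hi₀
    rw [← residue_eq_zero_iff]
    have := congrArg (fun p => p.coeff i₀) h
    simpa [P, Polynomial.coeff_monomial, Fin.val_inj] using this
  -- Substituting a ≡ l b turns the relation into P(l) b^n. An infinite residue field has an l with
  -- P(l) ≠ 0, so the coefficient of b^n is a unit.
  obtain ⟨l', hl'⟩ := Polynomial.exists_eval_ne_zero_of_natDegree_lt_card P hP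
    ((Cardinal.natCast_lt_aleph0 (n := P.natDegree)).trans_le (Cardinal.aleph0_le_mk _))
  obtain ⟨l, rfl⟩ := residue_surjective (R := S) l'
  refine ⟨l, ?_⟩
  set u : S := ∑ i : Fin (n + 1), c i * l ^ (i : ℕ)
  have hu : IsUnit u := by
    rw [← residue_ne_zero_iff_isUnit]
    convert hl' using 1
    simp [u, P, Polynomial.eval_finsetSum]
  have key : ∀ i : Fin (n + 1), a ^ (i : ℕ) * b ^ (n - i) - l ^ (i : ℕ) * b ^ n ∈
      Ideal.span {a - l * b} * I ^ (n - 1) := by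
    intro i
    obtain ⟨i, hi⟩ := i
    dsimp only
    have h1 : a ^ i * b ^ (n - i) - l ^ i * b ^ n = (a - l * b) *
        ((∑ j ∈ Finset.range i, a ^ j * (l * b) ^ (i - 1 - j)) * b ^ (n - i)) := by
      have h2 : b ^ n = b ^ i * b ^ (n - i) := by rw [← pow_add]; congr 1; omega
      rw [h2, ← mul_assoc (a - l * b), mul_comm (a - l * b), geom_sum₂_mul, mul_pow]
      ring
    rw [h1]
    refine Ideal.mul_mem_mul (Ideal.mem_span_singleton_self _) ?_
    rw [Finset.sum_mul]
    refine Ideal.sum_mem _ fun j hj => ?_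
    have hj := Finset.mem_range.1 hj
    have h3 : I ^ (n - 1) = I ^ j * I ^ (i - 1 - j) * I ^ (n - i) := by
      rw [← pow_add, ← pow_add]; congr 1; omega
    rw [h3]
    exact Ideal.mul_mem_mul (Ideal.mul_mem_mul (Ideal.pow_mem_pow ha _)
      (Ideal.pow_mem_pow (Ideal.mul_mem_left _ _ hb) _)) (Ideal.pow_mem_pow hb _)
  have hub : u * b ^ n ∈ Ideal.span {a - l * b} * I ^ (n - 1) ⊔ maximalIdeal S * I ^ n := by
    have : u * b ^ n = ∑ i : Fin (n + 1), c i * (a ^ (i : ℕ) * b ^ (n - i)) -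
        ∑ i : Fin (n + 1), c i * (a ^ (i : ℕ) * b ^ (n - i) - l ^ (i : ℕ) * b ^ n) := by
      rw [← Finset.sum_sub_distrib, Finset.sum_mul]
      exact Finset.sum_congr rfl fun i _ => by ring
    rw [this]
    exact sub_mem (Ideal.mem_sup_right hc)
      (Ideal.mem_sup_left (Ideal.sum_mem _ fun i _ => Ideal.mul_mem_left _ _ (key i)))
  exact (Ideal.unit_mul_mem_iff_mem _ hu).1 hub

theorem pow_add_le_of_pow_succ_le {S : Type*} [CommRing S] {I J : Ideal S} {b : S} {N : ℕ}
    (hb : b ∈ I) (h : I ^ (N + 1) ≤ (J ⊔ Ideal.span {b}) * I ^ N) (j : ℕ) :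
    I ^ (N + j + 1) ≤ J * I ^ (N + j) ⊔ Ideal.span {b ^ (j + 1)} * I ^ N := by
  induction j with
  | zero => simpa [Ideal.sup_mul] using h
  | succ j ih =>
    have h1 : I ^ (N + (j + 1) + 1) = I * I ^ (N + j + 1) := by ring
    rw [h1]
    refine (Ideal.mul_mono_right ih).trans ?_
    rw [Ideal.mul_sup]
    refine sup_le ?_ ?_
    · refine le_sup_of_le_left (le_of_eq ?_)
      rw [show N + (j + 1) = (N + j) + 1 by ring, pow_succ' I (N + j)]
      ring
    · have h2 : I * (Ideal.span {b ^ (j + 1)} * I ^ N) = Ideal.span {b ^ (j + 1)} * I ^ (N + 1) := by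
        ring
      rw [h2]
      refine (Ideal.mul_mono_right h).trans ?_
      rw [Ideal.sup_mul, Ideal.mul_sup]
      refine sup_le_sup ?_ (le_of_eq ?_)
      · have h3 : Ideal.span {b ^ (j + 1)} ≤ I ^ (j + 1) :=
          (Ideal.span_singleton_le_iff_mem _).2 (Ideal.pow_mem_pow hb _)
        refine (Ideal.mul_mono_left h3).trans (le_of_eq ?_)
        ring
      · rw [← mul_assoc, Ideal.span_singleton_mul_span_singleton, ← pow_succ]

/-- Trades the two generators a, b of a reduction for the single y = a - l b: a high power of b is
absorbed up to 𝔫 times a power of I, and Nakayama removes the error. -/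
theorem exists_pow_succ_le_sup_span_singleton [IsNoetherianRing S] [Infinite (ResidueField S)]
    {I : Ideal S} {n : ℕ} (hn0 : n ≠ 0) (hn : (I ^ n).spanFinrank ≤ n) {J : Ideal S}
    {a b : S} (ha : a ∈ I) (hb : b ∈ I) {N : ℕ}
    (h : I ^ (N + 1) ≤ (J ⊔ Ideal.span {a} ⊔ Ideal.span {b}) * I ^ N) :
    ∃ y ∈ I, ∃ N : ℕ, I ^ (N + 1) ≤ (J ⊔ Ideal.span {y}) * I ^ N := by
  obtain ⟨n, rfl⟩ := Nat.exists_eq_succ_of_ne_zero hn0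
  obtain ⟨l, hl⟩ := exists_pow_mem_of_spanFinrank_pow_le (IsNoetherian.noetherian _) hn ha hb
  have hy : a - l * b ∈ I := sub_mem ha (Ideal.mul_mem_left _ _ hb)
  refine ⟨a - l * b, hy, N + n, ?_⟩
  set J' := J ⊔ Ideal.span {a - l * b}
  have hle : J ⊔ Ideal.span {a} ⊔ Ideal.span {b} ≤ J' ⊔ Ideal.span {b} := by
    refine sup_le (sup_le (le_sup_of_le_left le_sup_left) ?_) le_sup_right
    rw [Ideal.span_singleton_le_iff_mem]
    have : a = (a - l * b) + l * b := by ring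
    rw [this]
    exact add_mem (Ideal.mem_sup_left (Ideal.mem_sup_right (Ideal.mem_span_singleton_self _)))
      (Ideal.mem_sup_right (Ideal.mul_mem_left _ _ (Ideal.mem_span_singleton_self _)))
  have h1 := pow_add_le_of_pow_succ_le hb (h.trans (Ideal.mul_mono_left hle)) n
  have h2 : Ideal.span {b ^ (n + 1)} * I ^ N ≤
      J' * I ^ (N + n) ⊔ maximalIdeal S • I ^ (N + n + 1) := by
    refine (Ideal.mul_mono_left ((Ideal.span_singleton_le_iff_mem _).2 hl)).trans ?_
    rw [Ideal.sup_mul]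
    refine sup_le_sup ?_ (le_of_eq ?_)
    · refine (Ideal.mul_mono_left (Ideal.mul_mono_left (le_sup_right : _ ≤ J'))).trans (le_of_eq ?_)
      rw [mul_assoc, ← pow_add]
      congr 2
      simp [add_comm]
    · rw [smul_eq_mul, mul_assoc, ← pow_add]
      congr 2
      simp [Nat.succ_eq_add_one]; ring
  exact Submodule.le_of_le_smul_of_le_jacobson_bot (IsNoetherian.noetherian _)
    (maximalIdeal_le_jacobson _) (h1.trans (sup_le le_sup_left h2))

/-- If `I ^ n` has at most `n ≥ 1` generators and the residue field is infinite, then `I` has a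
principal reduction. -/
theorem exists_pow_succ_eq_span_singleton_mul [IsNoetherianRing S] [Infinite (ResidueField S)]
    {I : Ideal S} {n : ℕ} (hn0 : n ≠ 0) (hn : (I ^ n).spanFinrank ≤ n) :
    ∃ y ∈ I, ∃ k : ℕ, I ^ (k + 1) = Ideal.span {y} * I ^ k := by
  classical
  have main : ∀ s : Finset S, ∀ y ∈ I, (s : Set S) ⊆ I → ∀ N : ℕ,
      I ^ (N + 1) ≤ (Ideal.span s ⊔ Ideal.span {y}) * I ^ N →
      ∃ y ∈ I, ∃ k : ℕ, I ^ (k + 1) ≤ Ideal.span {y} * I ^ k := by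
    intro s
    induction s using Finset.induction_on with
    | empty =>
      intro y hy _ N h
      exact ⟨y, hy, N, by simpa using h⟩
    | insert a s _ ih =>
      intro y hy hs N h
      rw [Finset.coe_insert, Set.insert_subset_iff] at hs
      rw [Finset.coe_insert, Ideal.span_insert, sup_comm (Ideal.span {a})] at h
      obtain ⟨y', hy', N', h'⟩ := exists_pow_succ_le_sup_span_singleton hn0 hn hs.1 hy h
      exact ih y' hy' hs.2 N' h'
  obtain ⟨s, hs⟩ := IsNoetherian.noetherian I
  have hs' : Ideal.span (s : Set S) = I := hs
  -- Starting from y = 0, the generators in s are merged into y one at a time.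
  obtain ⟨y, hy, k, h⟩ := main s 0 (zero_mem _) (hs' ▸ Ideal.subset_span) 0 (by simp [hs'])
  refine ⟨y, hy, k, le_antisymm h ?_⟩
  rw [pow_succ']
  exact Ideal.mul_mono_left ((Ideal.span_singleton_le_iff_mem _).2 hy)

end IsLocalRing

/-! ### The extension R(X) -/

namespace IsLocalRing

open Polynomial

/-- The local ring `R(X)`: the localization of `R[X]` at the extension of the maximal ideal. -/
abbrev GenericExtension (R : Type*) [CommRing R] [IsLocalRing R] : Type _ :=
  Localization.AtPrime ((maximalIdeal R).map (C : R →+* R[X]))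

namespace GenericExtension

variable (R : Type*) [CommRing R] [IsLocalRing R]

theorem map_algebraMap (I : Ideal R) : I.map (algebraMap R (GenericExtension R)) =
    (I.map (C : R →+* R[X])).map (algebraMap R[X] (GenericExtension R)) := by
  rw [Ideal.map_map, IsScalarTower.algebraMap_eq R R[X] (GenericExtension R)]
  rfl

theorem map_maximalIdeal : (maximalIdeal R).map (algebraMap R (GenericExtension R)) =
    maximalIdeal (GenericExtension R) := by
  rw [map_algebraMap, Localization.AtPrime.map_eq_maximalIdeal]

instance : Module.Flat R (GenericExtension R) := Module.Flat.trans R R[X] _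

instance : IsLocalHom (algebraMap R (GenericExtension R)) :=
  ((local_hom_TFAE (algebraMap R (GenericExtension R))).out 0 2).2 (map_maximalIdeal R).le

instance [IsNoetherianRing R] : IsNoetherianRing (GenericExtension R) :=
  IsLocalization.isNoetherianRing ((maximalIdeal R).map (C : R →+* R[X])).primeCompl _ inferInstance

instance : Infinite (ResidueField (GenericExtension R)) := by
  let f : ℕ → ResidueField (GenericExtension R) := fun i =>
    residue _ (algebraMap R[X] (GenericExtension R) (X ^ i))
  refine Infinite.of_injective f fun i j hij => ?_
  by_contra hne
  have h : algebraMap R[X] (GenericExtension R) (X ^ i - X ^ j) ∈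
      maximalIdeal (GenericExtension R) := by
    rw [← residue_eq_zero_iff, map_sub, map_sub, sub_eq_zero]
    exact hij
  rw [IsLocalization.AtPrime.to_map_mem_maximal_iff _ ((maximalIdeal R).map (C : R →+* R[X])),
    Ideal.mem_map_C_iff] at h
  have h1 := h i
  rw [coeff_sub, coeff_X_pow_self, coeff_X_pow, if_neg hne, sub_zero] at h1
  exact (Ideal.ne_top_iff_one _).1 (maximalIdeal.isMaximal R).ne_top h1

variable {R}

/-- By McCoy, a zero divisor of (R/J)[X] is killed by a nonzero constant; q has a unit coefficient,
so its image is regular. -/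
theorem mem_map_C_of_mul_mem {J : Ideal R} {q f : R[X]}
    (hq : q ∉ (maximalIdeal R).map (C : R →+* R[X])) (hqf : q * f ∈ J.map (C : R →+* R[X])) :
    f ∈ J.map (C : R →+* R[X]) := by
  have hmem : ∀ g : R[X], g ∈ J.map (C : R →+* R[X]) ↔ g.map (Ideal.Quotient.mk J) = 0 := by
    intro g
    simp [Ideal.mem_map_C_iff, Polynomial.ext_iff, Ideal.Quotient.eq_zero_iff_mem]
  have hreg : q.map (Ideal.Quotient.mk J) ∈ nonZeroDivisors (R ⧸ J)[X] := by
    by_contra hq'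
    obtain ⟨a, ha0, ha⟩ := Polynomial.notMem_nonZeroDivisors_iff.1 hq'
    rw [Ideal.mem_map_C_iff, not_forall] at hq
    obtain ⟨i, hi⟩ := hq
    have hu : IsUnit (Ideal.Quotient.mk J (q.coeff i)) :=
      (notMem_maximalIdeal.1 hi).map (Ideal.Quotient.mk J)
    have hai := congrArg (fun p => p.coeff i) ha
    simp only [coeff_smul, coeff_map, coeff_zero, smul_eq_mul] at hai
    exact ha0 (hu.mul_left_eq_zero.1 hai)
  rw [hmem] at hqf ⊢
  rw [Polynomial.map_mul] at hqf
  rw [mul_comm] at hqf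
  exact (mul_right_mem_nonZeroDivisors_eq_zero_iff hreg).1 hqf

/-- Colon ideals descend: clear the denominator of v and test the condition on each coefficient of
the numerator. Integral closedness of I is then needed only in R, not in R(X). -/
theorem mem_map_of_forall_mul_mem {J N K : Ideal R}
    (hK : ∀ r, (∀ s ∈ N, s * r ∈ J) → r ∈ K) {v : GenericExtension R}
    (hv : ∀ s ∈ N, algebraMap R (GenericExtension R) s * v ∈
      J.map (algebraMap R (GenericExtension R))) :
    v ∈ K.map (algebraMap R (GenericExtension R)) := by
  obtain ⟨p, q, rfl⟩ := IsLocalization.exists_mk'_eq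
    ((maximalIdeal R).map (C : R →+* R[X])).primeCompl v
  rw [map_algebraMap, IsLocalization.mk'_mem_map_algebraMap_iff]
  refine ⟨1, one_mem _, ?_⟩
  rw [one_mul, Ideal.mem_map_C_iff]
  intro i
  refine hK _ fun s hs => ?_
  have h1 := hv s hs
  rw [map_algebraMap, IsScalarTower.algebraMap_apply R R[X] (GenericExtension R),
    IsLocalization.mul_mk'_eq_mk'_of_mul, IsLocalization.mk'_mem_map_algebraMap_iff] at h1
  obtain ⟨u, hu, h2⟩ := h1
  have h3 := Ideal.mem_map_C_iff.1 (mem_map_C_of_mul_mem hu h2) i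
  rwa [algebraMap_eq, coeff_C_mul] at h3

end GenericExtension
end IsLocalRing

open IsLocalRing

/-! ### Integral elements over an ideal -/

section IntegralClosure

variable {R : Type*} [CommRing R]

/-- The determinantal trick: an element mapping a faithful finite ideal `N` into `I N` is integral
over `I`. -/
theorem Ideal.isIntegralElement_of_forall_mul_mem [Nontrivial R] {I N : Ideal R} (hN : N.FG)
    {t : R} (ht : t ∈ nonZeroDivisors R) (htN : t ∈ N) {v : R} (hv : ∀ s ∈ N, s * v ∈ I * N) :
    I.IsIntegralElement v := by
  have : Module.Finite R N := Module.Finite.iff_fg.2 hN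
  let f : Module.End R N := LinearMap.lsmul R N v
  have hrange : LinearMap.range f ≤ I • ⊤ := by
    rintro _ ⟨s, rfl⟩
    have hmap : (I • ⊤ : Submodule R N).map N.subtype = I * N := by
      rw [Submodule.map_smul'', Submodule.map_top, Submodule.range_subtype, smul_eq_mul]
    have h1 := hv s s.2
    rw [← hmap] at h1
    obtain ⟨w, hw, hws⟩ := h1
    have : f s = w := N.injective_subtype (by rw [hws]; simp [f, mul_comm])
    rwa [this]
  obtain ⟨p, hp, -, hcoeff, hp0⟩ :=
    LinearMap.exists_monic_and_natDegree_eq_and_coeff_mem_pow_and_aeval_eq_zero R f I hrange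
  have hpow : ∀ (i : ℕ) (x : N), (f ^ i) x = v ^ i • x := by
    intro i
    induction i with
    | zero => simp
    | succ i ih => intro x; rw [pow_succ', Module.End.mul_apply, ih, pow_succ', mul_smul]; rfl
  -- Cayley–Hamilton gives p(v) N = 0; evaluating at the regular element t ∈ N gives p(v) = 0.
  have hpv : p.eval v = 0 := by
    have h1 := congrArg (fun g : Module.End R N => (g ⟨t, htN⟩ : R)) hp0
    simp only [Polynomial.aeval_eq_sum_range, LinearMap.sum_apply, LinearMap.smul_apply, hpow,
      AddSubmonoidClass.coe_finsetSum, Submodule.coe_smul, smul_eq_mul, LinearMap.zero_apply,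
      Submodule.coe_zero, ← mul_assoc, ← Finset.sum_mul] at h1
    rw [← Polynomial.eval_eq_sum_range] at h1
    exact (mul_right_mem_nonZeroDivisors_eq_zero_iff ht).1 h1
  have hpos : 1 ≤ p.natDegree := by
    by_contra h
    have h0 : p = 1 := hp.natDegree_eq_zero.1 (by omega)
    simp [h0] at hpv
  refine ⟨p.natDegree, hpos, fun i => p.coeff (p.natDegree - i), ?_, ?_⟩
  · intro i hi
    have hi := Finset.mem_Icc.1 hi
    have h1 := hcoeff (p.natDegree - i)
    rwa [Nat.sub_sub_self hi.2] at h1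
  · rw [Polynomial.eval_eq_sum_range, ← Finset.sum_range_reflect, Finset.sum_range_succ'] at hpv
    rw [← hpv, add_comm]
    congr 1
    · rw [Finset.range_eq_Ico, Finset.sum_Ico_add' (fun i => p.coeff (p.natDegree + 1 - 1 - i) *
        v ^ (p.natDegree + 1 - 1 - i))]
      exact Finset.sum_congr (by ext; simp) (by simp)
    · simp [hp.coeff_natDegree]

theorem IsLocalRing.isIntegrallyClosedIdeal_maximalIdeal [IsLocalRing R] :
    (maximalIdeal R).IsIntegrallyClosedIdeal := by
  rintro x ⟨n, hn, a, ha, h⟩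
  refine Ideal.IsPrime.mem_of_pow_mem inferInstance n ?_
  rw [eq_neg_of_add_eq_zero_left h]
  refine neg_mem (Ideal.sum_mem _ fun i hi => Ideal.mul_mem_right _ _ ?_)
  exact Ideal.pow_le_self (by have := Finset.mem_Icc.1 hi; omega) (ha i hi)

end IntegralClosure

theorem Ideal.colength_span_singleton_ne_top {R : Type*} [CommRing R] [IsNoetherianRing R]
    (hdim : ringKrullDim R = 1) {t : R}
    (ht : t ∈ nonZeroDivisors R) : (Ideal.span {t}).colength ≠ ⊤ := by
  have : Ring.KrullDimLE 1 R := (Order.krullDimLE_iff _ _).2 hdim.le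
  exact Module.length_ne_top_iff.2 (isFiniteLength_quotient_span_singleton R ht)

/-! ### Primary ideals in dimension one and their reductions -/

section MaximalPrimary

variable {R : Type*} [CommRing R] [IsLocalRing R]

theorem IsLocalRing.isMaximalPrimary_maximalIdeal : (maximalIdeal R).IsMaximalPrimary :=
  ⟨(inferInstance : (maximalIdeal R).IsPrime).isPrimary,
    (inferInstance : (maximalIdeal R).IsPrime).isRadical.radical⟩

theorem Ideal.IsMaximalPrimary.le_maximalIdeal {I : Ideal R} (hI : I.IsMaximalPrimary) :
    I ≤ maximalIdeal R := hI.2 ▸ I.le_radical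

theorem Ideal.IsMaximalPrimary.exists_pow_le [IsNoetherianRing R] {I : Ideal R}
    (hI : I.IsMaximalPrimary) : ∃ n, maximalIdeal R ^ n ≤ I :=
  Ideal.exists_pow_le_of_le_radical_of_fg hI.2.ge (IsNoetherian.noetherian _)

theorem Ideal.IsMaximalPrimary.maximalIdeal_pow_loewyLength_le [IsNoetherianRing R] {I : Ideal R}
    (hI : I.IsMaximalPrimary) : maximalIdeal R ^ I.loewyLength ≤ I :=
  Nat.sInf_mem (s := {n : ℕ | maximalIdeal R ^ n ≤ I}) hI.exists_pow_le

theorem IsLocalRing.loewyLength_maximalIdeal_le_one : (maximalIdeal R).loewyLength ≤ 1 :=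
  Nat.sInf_le (by simp)

theorem IsCohenMacaulayLocal.exists_mem_nonZeroDivisors (hCM : IsCohenMacaulayLocal R)
    (hdim : ringKrullDim R = 1) : ∃ t ∈ maximalIdeal R, t ∈ nonZeroDivisors R := by
  obtain ⟨rs, hrs, hreg, hlen⟩ := hCM
  cases rs with
  | nil => simp [hdim] at hlen
  | cons t rs =>
    refine ⟨t, hrs t (by simp), ?_⟩
    have := ((RingTheory.Sequence.isRegular_cons_iff R t rs).1 hreg).1
    rw [mem_nonZeroDivisors_iff_right]
    intro x hx
    exact this (by simpa [mul_comm] using hx)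

variable [IsNoetherianRing R]

theorem Ideal.IsMaximalPrimary.exists_mem_nonZeroDivisors (hCM : IsCohenMacaulayLocal R)
    (hdim : ringKrullDim R = 1) {I : Ideal R} (hI : I.IsMaximalPrimary) (n : ℕ) :
    ∃ t ∈ I ^ n, t ∈ nonZeroDivisors R := by
  obtain ⟨t, ht, ht0⟩ := hCM.exists_mem_nonZeroDivisors hdim
  obtain ⟨k, hk⟩ := hI.exists_pow_le
  exact ⟨(t ^ k) ^ n, Ideal.pow_mem_pow (hk (Ideal.pow_mem_pow ht k)) n,
    pow_mem (pow_mem ht0 k) n⟩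

theorem Ideal.IsMaximalPrimary.colength_pow_ne_top (hCM : IsCohenMacaulayLocal R)
    (hdim : ringKrullDim R = 1) {I : Ideal R} (hI : I.IsMaximalPrimary) (n : ℕ) :
    (I ^ n).colength ≠ ⊤ := by
  obtain ⟨t, ht, ht0⟩ := hI.exists_mem_nonZeroDivisors hCM hdim n
  exact ne_top_of_le_ne_top (colength_span_singleton_ne_top hdim ht0)
    (colength_anti ((Ideal.span_singleton_le_iff_mem _).2 ht))

/-- After passing to `R(X)`, every primary ideal has a principal reduction. -/
theorem Ideal.IsMaximalPrimary.exists_reduction (hCM : IsCohenMacaulayLocal R)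
    (hdim : ringKrullDim R = 1) {I : Ideal R} (hI : I.IsMaximalPrimary) :
    ∃ y ∈ I.map (algebraMap R (GenericExtension R)), y ∈ nonZeroDivisors (GenericExtension R) ∧
      ∃ k : ℕ, (I ^ (k + 1)).map (algebraMap R (GenericExtension R)) =
        span {y} * (I ^ k).map (algebraMap R (GenericExtension R)) := by
  obtain ⟨t, ht, ht0⟩ := hCM.exists_mem_nonZeroDivisors hdim
  have htop := colength_span_singleton_ne_top hdim ht0
  set c := (span {t}).colength.toNat
  -- The bound c on the number of generators is the same for every power, so the exponent c + 1
  -- exceeds it.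
  have hc : ((I.map (algebraMap R (GenericExtension R))) ^ (c + 1)).spanFinrank ≤ c + 1 := by
    rw [← Ideal.map_pow]
    refine (Ideal.spanFinrank_map_le_of_fg _ (IsNoetherian.noetherian _)).trans ?_
    have h1 := spanFinrank_le_colength ht0 ht (hI.colength_pow_ne_top hCM hdim (c + 1))
    rw [← ENat.natCast_toNat htop, Nat.cast_le] at h1
    exact h1.trans (Nat.le_succ c)
  obtain ⟨y, hy, k, hk⟩ := exists_pow_succ_eq_span_singleton_mul c.succ_ne_zero hc
  rw [← Ideal.map_pow, ← Ideal.map_pow] at hk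
  refine ⟨y, hy, ?_, k, hk⟩
  -- A regular element of I^(k+1) stays regular by flatness and is a multiple of y, so y is regular.
  obtain ⟨s, hs, hs0⟩ := hI.exists_mem_nonZeroDivisors hCM hdim (k + 1)
  have hs1 := Ideal.mem_map_of_mem (algebraMap R (GenericExtension R)) hs
  rw [hk] at hs1
  obtain ⟨z, _, hz⟩ := Ideal.mem_span_singleton_mul.1 hs1
  have hs2 : algebraMap R (GenericExtension R) s ∈ nonZeroDivisors (GenericExtension R) := by
    have hreg := Module.Flat.isSMulRegular_of_nonZeroDivisors (M := GenericExtension R) hs0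
    refine mem_nonZeroDivisors_iff_right.2 fun x hx => hreg ?_
    simpa [Algebra.smul_def, mul_comm] using hx
  rw [← hz] at hs2
  exact (mul_mem_nonZeroDivisors.1 hs2).1

end MaximalPrimary

/-! ### Multiplicity and numbers of generators -/

section Multiplicity

variable {R : Type*} [CommRing R]

theorem Ideal.map_pow_add_eq_span_singleton_pow_mul {S : Type*} [CommRing S] [Algebra R S]
    {I : Ideal R} {y : S} {k : ℕ}
    (hk : (I ^ (k + 1)).map (algebraMap R S) = span {y} * (I ^ k).map (algebraMap R S)) (j : ℕ) :
    (I ^ (k + j)).map (algebraMap R S) = span {y} ^ j * (I ^ k).map (algebraMap R S) := by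
  induction j with
  | zero => simp
  | succ j ih =>
    rw [← add_assoc, pow_succ, Ideal.map_mul, ih, mul_assoc, ← Ideal.map_mul, ← pow_succ, hk]
    ring

theorem Ideal.normalizedHilbertSamuel_eq (hdim : ringKrullDim R = 1) (I : Ideal R) (n : ℕ) :
    I.normalizedHilbertSamuel n = ((I ^ n).colength.toNat : ℝ) / n := by
  have h : ((ringKrullDim R).unbotD 0).toNat = 1 := by rw [hdim]; rfl
  simp [normalizedHilbertSamuel, h, colength]

variable [IsLocalRing R] [IsNoetherianRing R]

theorem Ideal.IsMaximalPrimary.exists_reduction_tendsto (hCM : IsCohenMacaulayLocal R)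
    (hdim : ringKrullDim R = 1) {I : Ideal R} (hI : I.IsMaximalPrimary) :
    ∃ y ∈ I.map (algebraMap R (GenericExtension R)), y ∈ nonZeroDivisors (GenericExtension R) ∧
      (∃ k : ℕ, (I ^ (k + 1)).map (algebraMap R (GenericExtension R)) =
        span {y} * (I ^ k).map (algebraMap R (GenericExtension R))) ∧
      ∃ e : ℕ, (span {y}).colength = e ∧ Tendsto I.normalizedHilbertSamuel atTop (𝓝 (e : ℝ)) := by
  obtain ⟨y, hy, hy0, k, hk⟩ := hI.exists_reduction hCM hdim
  have hadd : ∀ j : ℕ, (I ^ (k + j)).colength = (I ^ k).colength + j * (span {y}).colength := by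
    intro j
    rw [← colength_map (GenericExtension.map_maximalIdeal R),
      map_pow_add_eq_span_singleton_pow_mul hk, colength_span_singleton_pow_mul hy0,
      colength_map (GenericExtension.map_maximalIdeal R)]
  have hytop : (span {y}).colength ≠ ⊤ := by
    intro h
    have := hI.colength_pow_ne_top hCM hdim (k + 1)
    rw [hadd, h] at this
    simp at this
  obtain ⟨e, he⟩ := ENat.ne_top_iff_exists.1 hytop
  obtain ⟨A, hA⟩ := ENat.ne_top_iff_exists.1 (hI.colength_pow_ne_top hCM hdim k)
  refine ⟨y, hy, hy0, ⟨k, hk⟩, e, he.symm, ?_⟩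
  -- For n = k + j, the length A + j e equals n e + (A - k e).
  have hlim : Tendsto (fun n : ℕ => (e : ℝ) + ((A : ℝ) - k * e) / n) atTop (𝓝 (e + 0)) :=
    tendsto_const_nhds.add (tendsto_const_div_atTop_nhds_zero_nat _)
  rw [add_zero] at hlim
  refine hlim.congr' ?_
  filter_upwards [eventually_ge_atTop (k + 1)] with n hn
  obtain ⟨j, rfl⟩ := Nat.exists_eq_add_of_le (Nat.le_of_succ_le hn)
  have hne : ((k + j : ℕ) : ℝ) ≠ 0 := Nat.cast_ne_zero.2 (by omega)
  rw [normalizedHilbertSamuel_eq hdim, hadd, ← he, ← hA]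
  have : (A + j * e : ℕ∞).toNat = A + j * e := by
    exact_mod_cast ENat.toNat_natCast (A + j * e)
  rw [this]
  field_simp
  push_cast
  ring

theorem Ideal.IsMaximalPrimary.tendsto_normalizedHilbertSamuel (hCM : IsCohenMacaulayLocal R)
    (hdim : ringKrullDim R = 1) {I : Ideal R} (hI : I.IsMaximalPrimary) :
    Tendsto I.normalizedHilbertSamuel atTop (𝓝 I.hilbertSamuelMultiplicity) := by
  obtain ⟨_, _, _, _, e, _, he⟩ := hI.exists_reduction_tendsto hCM hdim
  exact tendsto_nhds_limUnder ⟨_, he⟩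

/-- The embedding dimension is at most the multiplicity. -/
theorem IsLocalRing.spanFinrank_maximalIdeal_le_hilbertSamuelMultiplicity
    (hCM : IsCohenMacaulayLocal R) (hdim : ringKrullDim R = 1) :
    ((maximalIdeal R).spanFinrank : ℝ) ≤ (maximalIdeal R).hilbertSamuelMultiplicity := by
  have hm := isMaximalPrimary_maximalIdeal (R := R)
  obtain ⟨y, hy, hy0, -, e, he, hlim⟩ := hm.exists_reduction_tendsto hCM hdim
  have hmap := GenericExtension.map_maximalIdeal R
  have hfin : (maximalIdeal R).colength ≠ ⊤ := by simpa using hm.colength_pow_ne_top hCM hdim 1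
  -- Comparing the colengths of y𝔪S ⊆ 𝔪²S gives μ(𝔪) ≤ ℓ(S/y) = e(R).
  have h1 : Ideal.span {y} * (maximalIdeal R).map (algebraMap R (GenericExtension R)) ≤
      (maximalIdeal R * maximalIdeal R).map (algebraMap R (GenericExtension R)) := by
    rw [Ideal.map_mul]
    exact Ideal.mul_mono_left ((Ideal.span_singleton_le_iff_mem _).2 hy)
  have h2 := Ideal.colength_anti h1
  rw [Ideal.colength_map hmap, Ideal.colength_span_singleton_mul hy0, Ideal.colength_map hmap,
    Ideal.colength_maximalIdeal_mul, ENat.add_le_add_iff_left hfin, he, Nat.cast_le] at h2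
  rw [tendsto_nhds_unique (hm.tendsto_normalizedHilbertSamuel hCM hdim) hlim]
  exact Nat.cast_le.2 h2

theorem Ideal.IsMaximalPrimary.hilbertSamuelMultiplicity_le (hCM : IsCohenMacaulayLocal R)
    (hdim : ringKrullDim R = 1) {I : Ideal R} (hI : I.IsMaximalPrimary) :
    I.hilbertSamuelMultiplicity ≤
      I.loewyLength * (maximalIdeal R).hilbertSamuelMultiplicity := by
  have hm := isMaximalPrimary_maximalIdeal (R := R)
  have hlimm := hm.tendsto_normalizedHilbertSamuel hCM hdim
  set l := I.loewyLength
  have hl : maximalIdeal R ^ l ≤ I := hI.maximalIdeal_pow_loewyLength_le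
  -- Since I is proper, l > 0, so l n → ∞ and e(R) can be computed along this subsequence.
  have hl0 : l ≠ 0 := by
    intro h0
    rw [h0, pow_zero, Ideal.one_eq_top, top_le_iff] at hl
    exact hI.1.ne_top hl
  have hmul : Tendsto (fun n : ℕ => l * n) atTop atTop :=
    tendsto_id.const_mul_atTop' (Nat.pos_of_ne_zero hl0)
  refine le_of_tendsto_of_tendsto (hI.tendsto_normalizedHilbertSamuel hCM hdim)
    ((hlimm.comp hmul).const_mul (l : ℝ)) ?_
  filter_upwards [eventually_ge_atTop 1] with n hn
  have hn0 : (n : ℝ) ≠ 0 := Nat.cast_ne_zero.2 (by omega)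
  have hl0' : (l : ℝ) ≠ 0 := Nat.cast_ne_zero.2 hl0
  rw [Function.comp_apply, normalizedHilbertSamuel_eq hdim, normalizedHilbertSamuel_eq hdim,
    Nat.cast_mul, ← mul_div_assoc, mul_div_mul_left _ _ hl0']
  refine div_le_div_of_nonneg_right (Nat.cast_le.2 (ENat.toNat_le_toNat (colength_anti ?_)
    (hm.colength_pow_ne_top hCM hdim _))) (Nat.cast_nonneg n)
  rw [pow_mul]
  exact Ideal.pow_right_mono hl n

/-- An integrally closed primary ideal is `𝔪`-full over `R(X)`, hence has at least as many
generators as the maximal ideal. -/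
theorem Ideal.IsMaximalPrimary.spanFinrank_maximalIdeal_le (hCM : IsCohenMacaulayLocal R)
    (hdim : ringKrullDim R = 1) {I : Ideal R} (hI : I.IsMaximalPrimary)
    (hcl : I.IsIntegrallyClosedIdeal) :
    (maximalIdeal R).spanFinrank ≤ I.spanFinrank := by
  have hm := isMaximalPrimary_maximalIdeal (R := R)
  obtain ⟨y, hy, -, k, hk⟩ := hm.exists_reduction hCM hdim
  set m := maximalIdeal R
  have hfin : I.colength ≠ ⊤ := by simpa using hI.colength_pow_ne_top hCM hdim 1
  have hfinm : m.colength ≠ ⊤ := by simpa using hm.colength_pow_ne_top hCM hdim 1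
  have hmap := GenericExtension.map_maximalIdeal R
  obtain ⟨t, ht, ht0⟩ := hm.exists_mem_nonZeroDivisors hCM hdim (k + 1)
  -- If y v ∈ 𝔪IS, then 𝔪^(k+1) v ⊆ 𝔪^k (y v) S ⊆ I 𝔪^(k+1) S. By descent and the determinantal
  -- trick, v lies in the extension of elements integral over I, that is, of I.
  have hcolon : ∀ v, v ∈ I.map (algebraMap R (GenericExtension R)) ↔
      y * v ∈ (m * I).map (algebraMap R (GenericExtension R)) := by
    intro v
    constructor
    · intro hv
      rw [Ideal.map_mul]
      exact mul_mem_mul hy hv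
    · intro hv
      refine GenericExtension.mem_map_of_forall_mul_mem (J := I * m ^ (k + 1)) (N := m ^ (k + 1))
        (fun r hr => hcl r (isIntegralElement_of_forall_mul_mem (IsNoetherian.noetherian _)
          ht0 ht hr)) fun s hs => ?_
      have hs1 := Ideal.mem_map_of_mem (algebraMap R (GenericExtension R)) hs
      rw [hk] at hs1
      obtain ⟨z, hz, hzs⟩ := Ideal.mem_span_singleton_mul.1 hs1
      have h1 : algebraMap R (GenericExtension R) s * v = z * (y * v) := by rw [← hzs]; ring
      have h2 : I * m ^ (k + 1) = m ^ k * (m * I) := by ring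
      rw [h1, h2, Ideal.map_mul]
      exact mul_mem_mul hz hv
  have h1 := colength_eq_colength_colon_add hcolon
  rw [colength_map hmap, colength_map hmap, colength_maximalIdeal_mul] at h1
  have hI' := (ENat.add_le_add_iff_left hfin).1 h1.ge
  -- For 𝔪² only the inclusion 𝔪S ⊆ (𝔪²S : y) is needed: it gives μ(𝔪) ≤ ℓ(S/(𝔪², y)).
  obtain ⟨K, hK⟩ : ∃ K : Ideal (GenericExtension R), ∀ v, v ∈ K ↔
      y * v ∈ (m * m).map (algebraMap R (GenericExtension R)) :=
    ⟨Submodule.comap (LinearMap.mulLeft _ y) ((m * m).map (algebraMap R (GenericExtension R))),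
      fun _ => Iff.rfl⟩
  have h2 := colength_eq_colength_colon_add hK
  have h3 : K.colength ≤ m.colength := by
    rw [← colength_map hmap]
    refine colength_anti fun v hv => ?_
    rw [hK, Ideal.map_mul]
    exact mul_mem_mul hy hv
  have h4 : ((m * m).map (algebraMap R (GenericExtension R)) ⊔ span {y}).colength ≤
      ((m * I).map (algebraMap R (GenericExtension R)) ⊔ span {y}).colength :=
    colength_anti (sup_le_sup_right (Ideal.map_mono (mul_mono_right hI.le_maximalIdeal)) _)
  rw [colength_map hmap, colength_maximalIdeal_mul] at h2
  have h5 := h2.le.trans (add_le_add h3 (h4.trans hI'))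
  exact_mod_cast (ENat.add_le_add_iff_left hfinm).1 h5

end Multiplicity

/-! ### The equivalence -/

theorem mainTheorem2 {R : Type*} [CommRing R] [IsLocalRing R] [IsNoetherianRing R]
    (hCM : IsCohenMacaulayLocal R) (hdim : ringKrullDim R = 1) :
    (∀ I : Ideal R, I.IsMaximalPrimary →
      Tendsto I.normalizedHilbertSamuel atTop (𝓝 I.hilbertSamuelMultiplicity)) ∧
    ((∀ I : Ideal R, I.IsMaximalPrimary → I.IsIntegrallyClosedIdeal →
        I.hilbertSamuelMultiplicity ≤ (I.spanFinrank : ℝ) * (I.loewyLength : ℝ)) ↔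
      (IsLocalRing.maximalIdeal R).hilbertSamuelMultiplicity =
        ((IsLocalRing.maximalIdeal R).spanFinrank : ℝ)) := by
  refine ⟨fun I hI => hI.tendsto_normalizedHilbertSamuel hCM hdim, fun h => ?_, fun h I hI hcl => ?_⟩
  · refine le_antisymm ?_ (spanFinrank_maximalIdeal_le_hilbertSamuelMultiplicity hCM hdim)
    refine (h _ isMaximalPrimary_maximalIdeal isIntegrallyClosedIdeal_maximalIdeal).trans ?_
    exact mul_le_of_le_one_right (Nat.cast_nonneg _)
      (by exact_mod_cast loewyLength_maximalIdeal_le_one)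
  · refine (hI.hilbertSamuelMultiplicity_le hCM hdim).trans ?_
    rw [h, mul_comm]
    exact mul_le_mul_of_nonneg_right
      (Nat.cast_le.2 (hI.spanFinrank_maximalIdeal_le hCM hdim hcl)) (Nat.cast_nonneg _)
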